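/- Define the Legendre-Stirling numbers of the second kind $LS(n,k)$ ($n,k\ge 0$) by $x^n=\sum_{k=0}^{n}LS(n,k)\prod_{i=0}^{k-1}\bigl(x-i(i+1)\bigr)$, with $LS(n,k)=0$ for $k>n$; that is, $LS(n,k)=JS(n,k;1)$, where the Jacobi-Stirling numbers $JS(n,k;z)$ are defined by $x^n=\sum_{k=0}^{n}JS(n,k;z)\prod_{i=0}^{k-1}\bigl(x-i(z+i)\bigr)$. For an integer $k\ge 1$, let the Legendre-Stirling poset $P_k$ be the poset with $3k$ points labeled $1,2,\dots,3k$, whose order is generated by the relations $3i-2<_{P_k}3i-1$ and $3i<_{P_k}3i-1$ for $1\le i\le k$, and $3i-1<_{P_k}3i+2$ for $1\le i\le k-1$. A linear extension of $P_k$ is identified with the permutation $\pi=\pi_1\pi_2\cdots\pi_{3k}$ of $\{1,\dots,3k\}$ that lists the labels in increasing order with respect to the linear extension (so $\pi$ lists $a$ before $b$ whenever $a<_{P_k}b$); a descent of $\pi$ is an index $l$ with $1\le l\le 3k-1$ and $\pi_l>\pi_{l+1}$, in the usual order of the integers. Let $b_{k,j}$ be the number of linear extensions of $P_k$ with exactly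 $j$ descents. **Theorem.** For every integer $k\ge 1$, as formal power series in $t$, $$\sum_{n\ge 0}LS(n+k,n)\,t^n=\frac{\sum_{j=1}^{2k-1}b_{k,j}\,t^j}{(1-t)^{3k+1}}.$$ -/

import Mathlib

/-- The polynomial `∏_{i=0}^{k-1} (x - i (z + i))`, of degree `k`. -/
noncomputable def jacobiProd {R : Type*} [CommRing R] (z : R) (k : ℕ) : Polynomial R :=
  ∏ i ∈ Finset.range k, (Polynomial.X - Polynomial.C ((i : R) * (z + (i : R))))

theorem jacobiProd_monic {R : Type*} [CommRing R] (z : R) (k : ℕ) : (jacobiProd z k).Monic :=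
  Polynomial.monic_prod_of_monic _ _ fun _ _ => Polynomial.monic_X_sub_C _

theorem jacobiProd_degree {R : Type*} [CommRing R] [Nontrivial R] (z : R) (k : ℕ) :
    (jacobiProd z k).degree = k := by
  rw [Polynomial.degree_eq_natDegree (jacobiProd_monic z k).ne_zero, jacobiProd,
    Polynomial.natDegree_prod_of_monic _ _ fun _ _ => Polynomial.monic_X_sub_C _]
  simp only [Polynomial.natDegree_X_sub_C, Finset.sum_const, Finset.card_range, smul_eq_mul,
    mul_one]

/-- The polynomials `∏_{i<k} (x - i (z + i))`, `k = 0, 1, 2, …`, as a sequence of polynomials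
in which the `k`-th one has degree `k`. -/
noncomputable def jacobiSeq {R : Type*} [CommRing R] [Nontrivial R] (z : R) :
    Polynomial.Sequence R where
  elems' := jacobiProd z
  degree_eq' := jacobiProd_degree z

theorem jacobiSeq_leadingCoeff {R : Type*} [CommRing R] [Nontrivial R] (z : R) (k : ℕ) :
    IsUnit (jacobiSeq z k).leadingCoeff := by
  have h : (jacobiSeq z k).leadingCoeff = 1 := jacobiProd_monic z k
  rw [h]
  exact isUnit_one

/-- The Jacobi-Stirling number `JS(n, k; z)` of the second kind: the coefficient of
`∏_{i<k} (x - i (z + i))` in the expansion of `x ^ n` in the basis formed by these products. -/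
noncomputable def JS {R : Type*} [CommRing R] [IsDomain R] (z : R) (n k : ℕ) : R :=
  ((jacobiSeq z).basis (jacobiSeq_leadingCoeff z)).repr (Polynomial.X ^ n) k

/-- The Legendre-Stirling number of the second kind, `LS(n, k) = JS(n, k; 1)`. -/
noncomputable def LS (n k : ℕ) : ℤ := JS (1 : ℤ) n k

/-- The number of descents of the word `w₀ w₁ … w_{m-1}`, i.e. the number of `l` with
`l + 1 < m` and `w_l > w_{l+1}`. -/
noncomputable def des {m : ℕ} (w : Fin m → ℕ) : ℕ :=
  Set.ncard {l : Fin m | ∃ h : (l : ℕ) + 1 < m, w ⟨(l : ℕ) + 1, h⟩ < w l}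

/-- The linear extensions of a finite poset `P`: a total order that extends the order of `P` is
given as the bijection `e` that sends a point to its rank in the total order; so
`e.symm 0, e.symm 1, …` are the points of `P` in increasing order. -/
def linearExtensions (P : Type*) [PartialOrder P] [Fintype P] :
    Set (P ≃ Fin (Fintype.card P)) :=
  {e | ∀ x y : P, x ≤ y → e x ≤ e y}

/-- The permutation associated with a linear extension of a poset labeled by `ω`: the labels in
increasing order with respect to the linear extension. -/
def labelWord {P : Type*} [Fintype P] (ω : P → ℕ)
    (e : P ≃ Fin (Fintype.card P)) : Fin (Fintype.card P) → ℕ :=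
  fun l => ω (e.symm l)

/-- The points of the Legendre-Stirling poset `P_k`. For `1 ≤ i ≤ k` the points with the labels
`3i-2, 3i-1, 3i` are `(i-1, 0), (i-1, 1), (i-1, 2)`. -/
def LSPoset (k : ℕ) : Type := Fin k × Fin 3

instance (k : ℕ) : Fintype (LSPoset k) := inferInstanceAs (Fintype (Fin k × Fin 3))

instance (k : ℕ) : DecidableEq (LSPoset k) := inferInstanceAs (DecidableEq (Fin k × Fin 3))

/-- The order of `P_k`: the points labeled `2, 5, …, 3k-1` form a chain (in this order), and for
each `i` the points labeled `3i-2` and `3i` are minimal elements that are covered by the point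
labeled `3i-1` only. Hence `x ≤ y` iff `x = y`, or `y` is on the chain and the index `i` of `x`
is at most that of `y`. -/
instance (k : ℕ) : PartialOrder (LSPoset k) where
  le x y := x = y ∨ (y.2 = 1 ∧ x.1 ≤ y.1)
  le_refl x := Or.inl rfl
  le_trans x y z hxy hyz := by
    rcases hxy with rfl | ⟨_, h⟩
    · exact hyz
    · rcases hyz with rfl | ⟨hz, h'⟩
      · exact Or.inr ⟨‹_›, h⟩
      · exact Or.inr ⟨hz, h.trans h'⟩
  le_antisymm x y hxy hyx := by
    rcases hxy with h | ⟨hy, h⟩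
    · exact h
    · rcases hyx with h' | ⟨hx, h'⟩
      · exact h'.symm
      · exact Prod.ext (le_antisymm h h') (hx.trans hy.symm)

/-- The labeling of `P_k` by `1, …, 3k`. -/
def LSPoset.label {k : ℕ} (x : LSPoset k) : ℕ := 3 * (x.1 : ℕ) + (x.2 : ℕ) + 1

/-- The number `b_{k,j}` of linear extensions of `P_k` with exactly `j` descents. -/
noncomputable def lsDescentNumber (k j : ℕ) : ℕ :=
  Set.ncard {e ∈ linearExtensions (LSPoset k) | des (labelWord LSPoset.label e) = j}

/-! The proof counts one set in two ways. The recurrence for `LS` makes `LS (n + k) n` the complete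
homogeneous symmetric polynomial of degree `k` in the numbers `j (j + 1)`, `0 ≤ j ≤ n`, that is, the
sum of `∏ i, c i * (1 + c i)` over weakly increasing `c`. With `c` as the values on the chain of
`P_k`, the factor at `i` counts the pairs of values at the points labeled `3i-2` and `3i` (`i` from
`1`), so the sum counts the `(P, ω)`-partitions with parts at most `n` (`LS_add_eq_ncard`).

By Stanley's argument, each such partition is sorted by exactly one linear extension, and an
extension with `d` descents comes from `(n + 3k - d).choose (3k)` partitions
(`ncard_posetPartitions`), with generating function `t^d / (1 - t)^(3k+1)`. Summing over the
extensions, all of which have between `1` and `2k - 1` descents, gives the theorem. -/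

/-! ### Recurrence of the Jacobi-Stirling numbers -/

theorem X_mul_jacobiProd {R : Type*} [CommRing R] (z : R) (k : ℕ) :
    Polynomial.X * jacobiProd z k =
      jacobiProd z (k + 1) + ((k : R) * (z + k)) • jacobiProd z k := by
  rw [jacobiProd, jacobiProd, Finset.prod_range_succ, Polynomial.smul_eq_C_mul]
  ring

theorem jacobiSeq_basis_apply {R : Type*} [CommRing R] [IsDomain R] (z : R) (k : ℕ) :
    (jacobiSeq z).basis (jacobiSeq_leadingCoeff z) k = jacobiProd z k := by
  rw [Polynomial.Sequence.basis_eq_self]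
  rfl

theorem jacobiSeq_repr_jacobiProd {R : Type*} [CommRing R] [IsDomain R] (z : R) (k : ℕ) :
    ((jacobiSeq z).basis (jacobiSeq_leadingCoeff z)).repr (jacobiProd z k) =
      Finsupp.single k 1 := by
  rw [← jacobiSeq_basis_apply, Module.Basis.repr_self]

theorem jacobiSeq_repr_X_mul_zero {R : Type*} [CommRing R] [IsDomain R] (z : R)
    (p : Polynomial R) :
    ((jacobiSeq z).basis (jacobiSeq_leadingCoeff z)).repr (Polynomial.X * p) 0 = 0 := by
  set b := (jacobiSeq z).basis (jacobiSeq_leadingCoeff z) with hb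
  have h : (Finsupp.lapply 0 ∘ₗ b.repr.toLinearMap) ∘ₗ LinearMap.mulLeft R Polynomial.X =
      (0 : Polynomial R →ₗ[R] R) := by
    refine b.ext fun i => ?_
    simp only [LinearMap.comp_apply, LinearMap.mulLeft_apply, LinearEquiv.coe_coe,
      Finsupp.lapply_apply, LinearMap.zero_apply]
    rw [hb, jacobiSeq_basis_apply, X_mul_jacobiProd, LinearEquiv.map_add, LinearEquiv.map_smul,
      jacobiSeq_repr_jacobiProd, jacobiSeq_repr_jacobiProd]
    rcases i with _ | i <;> simp
  exact LinearMap.congr_fun h p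

/-- Both sides are linear in `p`, so it suffices to take `p` in the basis, where `X_mul_jacobiProd`
has two terms. -/
theorem jacobiSeq_repr_X_mul_succ {R : Type*} [CommRing R] [IsDomain R] (z : R)
    (p : Polynomial R) (k : ℕ) :
    ((jacobiSeq z).basis (jacobiSeq_leadingCoeff z)).repr (Polynomial.X * p) (k + 1) =
      ((jacobiSeq z).basis (jacobiSeq_leadingCoeff z)).repr p k +
        ((k + 1 : ℕ) : R) * (z + ((k + 1 : ℕ) : R)) *
          ((jacobiSeq z).basis (jacobiSeq_leadingCoeff z)).repr p (k + 1) := by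
  set b := (jacobiSeq z).basis (jacobiSeq_leadingCoeff z) with hb
  have h : (Finsupp.lapply (k + 1) ∘ₗ b.repr.toLinearMap) ∘ₗ LinearMap.mulLeft R Polynomial.X =
      Finsupp.lapply k ∘ₗ b.repr.toLinearMap +
        (((k + 1 : ℕ) : R) * (z + ((k + 1 : ℕ) : R))) •
          (Finsupp.lapply (k + 1) ∘ₗ b.repr.toLinearMap) := by
    refine b.ext fun i => ?_
    simp only [LinearMap.comp_apply, LinearMap.mulLeft_apply, LinearEquiv.coe_coe,
      Finsupp.lapply_apply, LinearMap.add_apply, LinearMap.smul_apply]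
    rw [hb, jacobiSeq_basis_apply, X_mul_jacobiProd, LinearEquiv.map_add, LinearEquiv.map_smul,
      jacobiSeq_repr_jacobiProd, jacobiSeq_repr_jacobiProd]
    by_cases hi : i = k + 1
    · subst hi
      simp
    · simp [Finsupp.single_apply, hi]
  exact LinearMap.congr_fun h p

theorem JS_zero_zero {R : Type*} [CommRing R] [IsDomain R] (z : R) : JS z 0 0 = 1 := by
  have h : (Polynomial.X ^ 0 : Polynomial R) = jacobiProd z 0 := by simp [jacobiProd]
  rw [JS, h, jacobiSeq_repr_jacobiProd, Finsupp.single_eq_same]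

theorem JS_zero_succ {R : Type*} [CommRing R] [IsDomain R] (z : R) (k : ℕ) :
    JS z 0 (k + 1) = 0 := by
  have h : (Polynomial.X ^ 0 : Polynomial R) = jacobiProd z 0 := by simp [jacobiProd]
  rw [JS, h, jacobiSeq_repr_jacobiProd, Finsupp.single_eq_of_ne (by simp)]

theorem JS_succ_zero {R : Type*} [CommRing R] [IsDomain R] (z : R) (n : ℕ) :
    JS z (n + 1) 0 = 0 := by
  rw [JS, pow_succ', jacobiSeq_repr_X_mul_zero]

theorem JS_succ_succ {R : Type*} [CommRing R] [IsDomain R] (z : R) (n k : ℕ) :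
    JS z (n + 1) (k + 1) =
      JS z n k + ((k + 1 : ℕ) : R) * (z + ((k + 1 : ℕ) : R)) * JS z n (k + 1) := by
  rw [JS, pow_succ', jacobiSeq_repr_X_mul_succ, JS, JS]

theorem JS_eq_zero_of_lt {R : Type*} [CommRing R] [IsDomain R] (z : R) :
    ∀ {n k : ℕ}, n < k → JS z n k = 0
  | 0, k + 1, _ => JS_zero_succ z k
  | n + 1, k + 1, h => by
    rw [JS_succ_succ, JS_eq_zero_of_lt z (Nat.lt_of_succ_lt_succ h),
      JS_eq_zero_of_lt z (Nat.lt_of_succ_lt h), mul_zero, add_zero]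

theorem JS_self {R : Type*} [CommRing R] [IsDomain R] (z : R) : ∀ n : ℕ, JS z n n = 1
  | 0 => JS_zero_zero z
  | n + 1 => by
    rw [JS_succ_succ, JS_self z n, JS_eq_zero_of_lt z (Nat.lt_succ_self n), mul_zero, add_zero]

/-! ### Jacobi-Stirling numbers as complete homogeneous symmetric polynomials -/

/-- The monotone maps from `Fin k` to `{0, …, n}`. -/
def monotoneTuples (k n : ℕ) : Finset (Fin k → ℕ) :=
  (Fintype.piFinset fun _ => Finset.range (n + 1)).filter Monotone

theorem mem_monotoneTuples {k n : ℕ} {c : Fin k → ℕ} :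
    c ∈ monotoneTuples k n ↔ (∀ i, c i ≤ n) ∧ Monotone c := by
  simp [monotoneTuples]

/-- The cases are whether the last, hence largest, entry is at most `n` or equal to `n + 1`. -/
theorem monotoneTuples_succ_succ (k n : ℕ) :
    monotoneTuples (k + 1) (n + 1) = monotoneTuples (k + 1) n ∪
      (monotoneTuples k (n + 1)).image fun c => Fin.snoc (α := fun _ => ℕ) c (n + 1) := by
  ext c
  simp only [Finset.mem_union, Finset.mem_image, mem_monotoneTuples]
  constructor
  · rintro ⟨hb, hm⟩
    by_cases hl : c (Fin.last k) ≤ n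
    · exact Or.inl ⟨fun i => (hm (Fin.le_last i)).trans hl, hm⟩
    · refine Or.inr ⟨Fin.init c, ⟨fun i => hb _, fun i j hij => hm ?_⟩, ?_⟩
      · exact Fin.castSucc_le_castSucc_iff.2 hij
      · have : c (Fin.last k) = n + 1 := le_antisymm (hb _) (Nat.lt_of_not_le hl)
        rw [← this, Fin.snoc_init_self]
  · rintro (⟨hb, hm⟩ | ⟨c, ⟨hb, hm⟩, rfl⟩)
    · exact ⟨fun i => (hb i).trans n.le_succ, hm⟩
    · have hb' : ∀ i, Fin.snoc (α := fun _ => ℕ) c (n + 1) i ≤ n + 1 := by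
        intro i
        induction i using Fin.lastCases with
        | last => simp
        | cast i => simpa using hb i
      refine ⟨hb', fun i j hij => ?_⟩
      induction j using Fin.lastCases with
      | last => simpa using hb' i
      | cast j =>
        induction i using Fin.lastCases with
        | last => exact absurd hij (not_le.2 (Fin.castSucc_lt_last j))
        | cast i => simpa using hm (Fin.castSucc_le_castSucc_iff.1 hij)

theorem sum_monotoneTuples_succ_succ {R : Type*} [CommSemiring R] (a : ℕ → R) (k n : ℕ) :
    ∑ c ∈ monotoneTuples (k + 1) (n + 1), ∏ i, a (c i) =
      ∑ c ∈ monotoneTuples (k + 1) n, ∏ i, a (c i) +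
        a (n + 1) * ∑ c ∈ monotoneTuples k (n + 1), ∏ i, a (c i) := by
  rw [monotoneTuples_succ_succ, Finset.sum_union, Finset.sum_image, Finset.mul_sum]
  · congr 1
    refine Finset.sum_congr rfl fun c _ => ?_
    rw [Fin.prod_univ_castSucc, mul_comm]
    simp
  · intro c _ c' _ h
    exact (Fin.snoc_inj.1 h).1
  · refine Finset.disjoint_left.2 fun c hc hc' => ?_
    obtain ⟨c', _, rfl⟩ := Finset.mem_image.1 hc'
    have := (mem_monotoneTuples.1 hc).1 (Fin.last k)
    simp at this

theorem JS_add_eq_sum_monotoneTuples {R : Type*} [CommRing R] [IsDomain R] (z : R) :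
    ∀ k n : ℕ, JS z (n + k) n =
      ∑ c ∈ monotoneTuples k n, ∏ i, ((c i : R) * (z + (c i : R)))
  | 0, n => by
    have : monotoneTuples 0 n = Finset.univ := by
      ext c
      simp only [mem_monotoneTuples, Finset.mem_univ, iff_true]
      exact ⟨fun i => i.elim0, Subsingleton.monotone c⟩
    rw [this]
    simp [JS_self]
  | k + 1, 0 => by
    rw [zero_add, JS_succ_zero]
    refine (Finset.sum_eq_zero fun c hc => Finset.prod_eq_zero (Finset.mem_univ 0) ?_).symm
    rw [Nat.le_zero.1 ((mem_monotoneTuples.1 hc).1 0), Nat.cast_zero, zero_mul]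
  | k + 1, n + 1 => by
    rw [sum_monotoneTuples_succ_succ (fun j : ℕ => (j : R) * (z + (j : R))),
      ← JS_add_eq_sum_monotoneTuples z (k + 1) n, ← JS_add_eq_sum_monotoneTuples z k (n + 1),
      ← add_assoc, JS_succ_succ, show n + 1 + k = n + (k + 1) by ring]

/-! ### Descents of words -/

/-- The position `j` is a descent of the word `w`. -/
def IsDescent {m : ℕ} (w : Fin m → ℕ) (j : ℕ) : Prop :=
  ∃ h : j + 1 < m, w ⟨j + 1, h⟩ < w ⟨j, Nat.lt_of_succ_lt h⟩

noncomputable instance {m : ℕ} (w : Fin m → ℕ) : DecidablePred (IsDescent w) :=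
  Classical.decPred _

/-- The number of descents of the word `w` at positions before `l`. -/
noncomputable def descentsBefore {m : ℕ} (w : Fin m → ℕ) (l : ℕ) : ℕ :=
  Nat.count (IsDescent w) l

theorem descentsBefore_succ_of_isDescent {m : ℕ} {w : Fin m → ℕ} {l : ℕ} (h : IsDescent w l) :
    descentsBefore w (l + 1) = descentsBefore w l + 1 := by
  rw [descentsBefore, Nat.count_succ, if_pos h, descentsBefore]

theorem descentsBefore_succ_of_not_isDescent {m : ℕ} {w : Fin m → ℕ} {l : ℕ}
    (h : ¬IsDescent w l) : descentsBefore w (l + 1) = descentsBefore w l := by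
  rw [descentsBefore, Nat.count_succ, if_neg h, descentsBefore, add_zero]

theorem descentsBefore_le {m : ℕ} (w : Fin m → ℕ) (l : ℕ) : descentsBefore w l ≤ l :=
  Nat.count_le _

theorem descentsBefore_mono {m : ℕ} (w : Fin m → ℕ) : Monotone (descentsBefore w) :=
  Nat.count_monotone _

/-- At most `j - i` descents lie between `i` and `j`; equivalently, the number of non-descents
before a position is monotone. -/
theorem descentsBefore_add_le {m : ℕ} (w : Fin m → ℕ) {i j : ℕ} (h : i ≤ j) :
    descentsBefore w j + i ≤ descentsBefore w i + j := by
  induction j, h using Nat.le_induction with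
  | base => exact le_rfl
  | succ j _ ih =>
    by_cases hd : IsDescent w j
    · rw [descentsBefore_succ_of_isDescent hd]
      omega
    · rw [descentsBefore_succ_of_not_isDescent hd]
      omega

theorem descentsBefore_length {m : ℕ} (w : Fin m → ℕ) : descentsBefore w m = des w := by
  rw [descentsBefore, Nat.count_eq_card_filter_range, des, ← Set.ncard_coe_finset]
  symm
  refine Set.ncard_congr (fun l _ => (l : ℕ)) ?_ ?_ ?_
  · intro l hl
    exact Finset.mem_coe.2 (Finset.mem_filter.2 ⟨Finset.mem_range.2 l.2, hl⟩)
  · intro a b _ _ h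
    exact Fin.ext h
  · intro l hl
    obtain ⟨hlt, hd⟩ := Finset.mem_filter.1 (Finset.mem_coe.1 hl)
    exact ⟨⟨l, Finset.mem_range.1 hlt⟩, hd, rfl⟩

theorem descentsBefore_pred {m : ℕ} (w : Fin m → ℕ) : descentsBefore w (m - 1) = des w := by
  rcases m with _ | q
  · exact descentsBefore_length w
  rw [Nat.add_sub_cancel]
  rw [← descentsBefore_length, descentsBefore_succ_of_not_isDescent]
  rintro ⟨h, _⟩
  exact lt_irrefl _ h

/-- Without a descent from `i` to `j` the word would increase weakly there. -/
theorem descentsBefore_lt {m : ℕ} {w : Fin m → ℕ} {i j : Fin m} (hij : i < j)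
    (h : w j < w i) : descentsBefore w i < descentsBefore w j := by
  obtain ⟨j, hj⟩ := j
  have hij' : (i : ℕ) ≤ j := le_of_lt hij
  clear hij
  induction j, hij' using Nat.le_induction with
  | base => exact absurd h (lt_irrefl _)
  | succ j hle ih =>
    by_cases hd : IsDescent w j
    · rw [descentsBefore_succ_of_isDescent hd]
      exact Nat.lt_succ_of_le (descentsBefore_mono w hle)
    · rw [descentsBefore_succ_of_not_isDescent hd]
      refine ih (Nat.lt_of_succ_lt hj) (lt_of_le_of_lt ?_ h)
      exact not_lt.1 fun hlt => hd ⟨hj, hlt⟩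

theorem descentsBefore_add_lt {m : ℕ} {w : Fin m → ℕ} {i j : Fin m} (hij : i < j)
    (h : w i < w j) : descentsBefore w j + i < descentsBefore w i + j := by
  obtain ⟨j, hj⟩ := j
  have hij' : (i : ℕ) ≤ j := le_of_lt hij
  clear hij
  induction j, hij' using Nat.le_induction with
  | base => exact absurd h (lt_irrefl _)
  | succ j hle ih =>
    by_cases hd : IsDescent w j
    · have := ih (Nat.lt_of_succ_lt hj) (h.trans hd.2)
      rw [descentsBefore_succ_of_isDescent hd]
      simp only at this ⊢
      omega
    · have := descentsBefore_add_le w hle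
      rw [descentsBefore_succ_of_not_isDescent hd]
      simp only at this ⊢
      omega

/-! ### Sequences compatible with a word -/

theorem strictMono_fin_le_apply {m : ℕ} {h : Fin m → ℕ} (hm : StrictMono h) :
    ∀ i : Fin m, (i : ℕ) ≤ h i
  | ⟨0, _⟩ => Nat.zero_le _
  | ⟨i + 1, hi⟩ =>
    Nat.succ_le_of_lt <| (strictMono_fin_le_apply hm ⟨i, Nat.lt_of_succ_lt hi⟩).trans_lt
      (hm (Fin.mk_lt_mk.2 i.lt_succ_self))

theorem ncard_strictMono_lt (m N : ℕ) :
    {h : Fin m → ℕ | StrictMono h ∧ ∀ i, h i < N}.ncard = N.choose m := by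
  rw [← Finset.card_range N, ← Finset.card_powersetCard, Finset.card_range,
    ← Set.ncard_coe_finset]
  refine Set.ncard_congr (fun h _ => Finset.univ.image h) ?_ ?_ ?_
  · rintro h ⟨hm, hb⟩
    refine Finset.mem_coe.2 (Finset.mem_powersetCard.2 ⟨?_, ?_⟩)
    · intro x hx
      obtain ⟨i, _, rfl⟩ := Finset.mem_image.1 hx
      exact Finset.mem_range.2 (hb i)
    · rw [Finset.card_image_of_injective _ hm.injective, Finset.card_fin]
  · rintro h h' ⟨hm, _⟩ ⟨hm', _⟩ heq
    refine (hm.range_inj hm').1 ?_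
    simpa using congrArg (fun s : Finset ℕ => (s : Set ℕ)) heq
  · intro s hs
    obtain ⟨hs, hc⟩ := Finset.mem_powersetCard.1 (Finset.mem_coe.1 hs)
    refine ⟨s.orderEmbOfFin hc, ⟨(s.orderEmbOfFin hc).strictMono, fun i => ?_⟩, ?_⟩
    · exact Finset.mem_range.1 (hs (Finset.orderEmbOfFin_mem s hc i))
    · exact Finset.image_orderEmbOfFin_univ s hc

/-- The sequences bounded by `n` that increase weakly, and strictly at the descents of `w`. -/
def wordSequences {m : ℕ} (w : Fin m → ℕ) (n : ℕ) : Set (Fin m → ℕ) :=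
  {g | StrictMono (fun i => toLex (g i, w i)) ∧ ∀ i, g i ≤ n}

/-- The shift counts the non-descents before `i`. It grows by one exactly where `g` need only
increase weakly, and is constant where `g` must increase strictly. -/
theorem strictMono_toLex_iff_shift {m : ℕ} {w : Fin m → ℕ} (hw : Function.Injective w)
    (g : Fin m → ℕ) : StrictMono (fun i => toLex (g i, w i)) ↔
      StrictMono fun i : Fin m => g i + (i - descentsBefore w i) := by
  rcases m with _ | q
  · exact iff_of_true (fun i => i.elim0) fun i => i.elim0
  rw [Fin.strictMono_iff_lt_succ, Fin.strictMono_iff_lt_succ]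
  refine forall_congr' fun i => ?_
  rw [Prod.Lex.toLex_lt_toLex]
  have hne : w i.castSucc ≠ w i.succ := fun h => (Fin.castSucc_lt_succ (i := i)).ne (hw h)
  have hle := descentsBefore_le w i
  simp only [Fin.val_castSucc, Fin.val_succ]
  by_cases hd : IsDescent w i
  · have hlt : w i.succ < w i.castSucc := hd.2
    rw [descentsBefore_succ_of_isDescent hd]
    omega
  · have hlt : ¬w i.succ < w i.castSucc := fun h => hd ⟨Nat.succ_lt_succ i.2, h⟩
    rw [descentsBefore_succ_of_not_isDescent hd]
    omega

/-- The shift at the last position is `m - 1 - des w`, so the shifted sequences are the strictly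
increasing ones with values below `n + m - des w`. -/
theorem ncard_wordSequences {m : ℕ} {w : Fin m → ℕ} (hw : Function.Injective w) (n : ℕ) :
    (wordSequences w n).ncard = (n + m - des w).choose m := by
  rw [← ncard_strictMono_lt]
  refine Set.ncard_congr (fun g _ i => g i + (i - descentsBefore w i)) ?_ ?_ ?_
  · rintro g ⟨hm, hb⟩
    have hm' := (strictMono_toLex_iff_shift hw g).1 hm
    refine ⟨hm', ?_⟩
    rcases m with _ | q
    · exact fun i => i.elim0
    · intro i
      refine (hm'.monotone (Fin.le_last i)).trans_lt ?_
      have h1 := hb (Fin.last q)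
      have h2 := descentsBefore_le w q
      have h3 : descentsBefore w q = des w := descentsBefore_pred w
      simp only [Fin.val_last]
      omega
  · intro g g' _ _ h
    funext i
    exact Nat.add_right_cancel (congrFun h i)
  · rintro h ⟨hm, hb⟩
    -- This makes the truncated subtraction of the shift exact.
    have hge : ∀ i : Fin m, (i : ℕ) - descentsBefore w i ≤ h i := fun i =>
      (Nat.sub_le _ _).trans (strictMono_fin_le_apply hm i)
    have heq : (fun i : Fin m => h i - (i - descentsBefore w i) + (i - descentsBefore w i)) = h :=
      funext fun i => Nat.sub_add_cancel (hge i)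
    have hm' : StrictMono fun i : Fin m => toLex (h i - (i - descentsBefore w i), w i) := by
      rw [strictMono_toLex_iff_shift hw fun i : Fin m => h i - (i - descentsBefore w i), heq]
      exact hm
    refine ⟨fun i => h i - (i - descentsBefore w i), ⟨hm', ?_⟩, heq⟩
    rcases m with _ | q
    · exact fun i => i.elim0
    · intro i
      have hl : h (Fin.last q) - (q - descentsBefore w q) ≤ n := by
        have h1 := hb (Fin.last q)
        have h2 := descentsBefore_le w q
        have h3 : descentsBefore w q = des w := descentsBefore_pred w
        omega
      refine le_trans ?_ hl
      have := hm'.monotone (Fin.le_last i)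
      rcases (Prod.Lex.toLex_le_toLex).1 this with h | h
      · exact h.le
      · exact h.1.le

/-! ### `(P, ω)`-partitions and linear extensions -/

theorem existsUnique_strictMono_symm {P α : Type*} [Fintype P] [LinearOrder α] {κ : P → α}
    (hκ : Function.Injective κ) :
    ∃! e : P ≃ Fin (Fintype.card P), StrictMono fun i => κ (e.symm i) := by
  let _ : LinearOrder P := LinearOrder.lift' κ hκ
  refine ⟨(monoEquivOfFin P rfl).toEquiv.symm,
    fun i j hij => (monoEquivOfFin P rfl).strictMono hij, fun e he => ?_⟩
  set e' := (monoEquivOfFin P rfl).toEquiv.symm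
  have he' : StrictMono fun i => κ (e'.symm i) :=
    fun i j hij => (monoEquivOfFin P rfl).strictMono hij
  have hr : Set.range (fun i => κ (e.symm i)) = Set.range fun i => κ (e'.symm i) := by
    rw [show (fun i => κ (e.symm i)) = κ ∘ e.symm from rfl,
      show (fun i => κ (e'.symm i)) = κ ∘ e'.symm from rfl,
      e.symm.surjective.range_comp, e'.symm.surjective.range_comp]
  have h := (he.range_inj he').1 hr
  exact Equiv.symm_bijective.injective (Equiv.ext fun i => hκ (congrFun h i))

/-- The `(P, ω)`-partitions with parts at most `n`: the order-preserving maps from `P` to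
`{0, …, n}` that increase strictly along the relations that are inversions of the labeling. -/
def posetPartitions {P : Type*} [PartialOrder P] (ω : P → ℕ) (n : ℕ) : Set (P → ℕ) :=
  {f | (∀ x y, x < y → toLex (f x, ω x) < toLex (f y, ω y)) ∧ ∀ x, f x ≤ n}

theorem posetPartitions_finite {P : Type*} [PartialOrder P] [Fintype P] (ω : P → ℕ) (n : ℕ) :
    (posetPartitions ω n).Finite :=
  (Set.Finite.pi' fun _ : P => Set.finite_Iic n).subset fun _ hf => hf.2

theorem labelWord_injective {P : Type*} [Fintype P] {ω : P → ℕ} (hω : Function.Injective ω)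
    (e : P ≃ Fin (Fintype.card P)) : Function.Injective (labelWord ω e) :=
  hω.comp e.symm.injective

theorem mem_linearExtensions_iff {P : Type*} [PartialOrder P] [Fintype P]
    {e : P ≃ Fin (Fintype.card P)} :
    e ∈ linearExtensions P ↔ ∀ x y : P, x < y → e x < e y := by
  refine ⟨fun h x y hxy => lt_of_le_of_ne (h x y hxy.le) fun he => hxy.ne (e.injective he),
    fun h x y hxy => ?_⟩
  rcases hxy.eq_or_lt with rfl | hlt
  · exact le_rfl
  · exact (h x y hlt).le

theorem strictMono_symm_lt_iff {P α : Type*} [Fintype P] [LinearOrder α] {κ : P → α}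
    {e : P ≃ Fin (Fintype.card P)} (he : StrictMono fun i => κ (e.symm i)) (x y : P) :
    κ x < κ y ↔ e x < e y := by
  simpa using he.lt_iff_lt (a := e x) (b := e y)

/-- Injective labels break ties, so the keys `(f x, ω x)` order `P` totally; `f` is a partition only
if this order extends that of `P`. The fiber over `e` is `wordSequences (labelWord ω e) n`. -/
theorem ncard_posetPartitions {P : Type*} [PartialOrder P] [Fintype P] {ω : P → ℕ}
    (hω : Function.Injective ω) (n : ℕ) :
    (posetPartitions ω n).ncard = ∑ e ∈ (linearExtensions P).toFinite.toFinset,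
      (n + Fintype.card P - des (labelWord ω e)).choose (Fintype.card P) := by
  classical
  have hκ : ∀ f : P → ℕ, Function.Injective fun x => toLex (f x, ω x) := fun f x y h =>
    hω (congrArg (fun p => (ofLex p).2) h)
  choose s hs hu using fun f : P → ℕ => existsUnique_strictMono_symm (hκ f)
  have hmaps : Set.MapsTo s (posetPartitions_finite ω n).toFinset
      (linearExtensions P).toFinite.toFinset := by
    intro f hf
    rw [Set.Finite.coe_toFinset] at hf ⊢
    exact mem_linearExtensions_iff.2 fun x y hxy =>
      (strictMono_symm_lt_iff (κ := fun x => toLex (f x, ω x)) (hs f) x y).1 (hf.1 x y hxy)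
  rw [Set.ncard_eq_toFinset_card _ (posetPartitions_finite ω n),
    Finset.card_eq_sum_card_fiberwise hmaps]
  refine Finset.sum_congr rfl fun e he => ?_
  rw [← ncard_wordSequences (labelWord_injective hω e), ← Set.ncard_coe_finset]
  rw [Set.Finite.mem_toFinset, mem_linearExtensions_iff] at he
  refine Set.ncard_congr (fun f _ i => f (e.symm i)) ?_ ?_ ?_
  · intro f hf
    rw [Finset.mem_coe, Finset.mem_filter, Set.Finite.mem_toFinset] at hf
    obtain ⟨hf, rfl⟩ := hf
    exact ⟨hs f, fun i => hf.2 _⟩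
  · intro f f' _ _ h
    funext x
    simpa using congrFun h (e x)
  · rintro g ⟨hg, hb⟩
    have hg' : StrictMono fun i => toLex (g (e (e.symm i)), ω (e.symm i)) := by
      simpa [labelWord] using hg
    refine ⟨fun x => g (e x), ?_, by simp⟩
    rw [Finset.mem_coe, Finset.mem_filter, Set.Finite.mem_toFinset]
    refine ⟨⟨fun x y hxy => ?_, fun x => hb _⟩, (hu _ e hg').symm⟩
    exact (strictMono_symm_lt_iff (κ := fun x => toLex (g (e x), ω x)) hg' x y).2 (he x y hxy)

/-! ### Generating functions -/

theorem mk_choose_eq_X_pow_mul {p d : ℕ} (hd : d ≤ p) :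
    (PowerSeries.mk fun n : ℕ => ((n + p - d).choose p : ℚ)) =
      PowerSeries.X ^ d * ((1 - (PowerSeries.X : PowerSeries ℚ)) ^ (p + 1))⁻¹ := by
  have hinv : ((1 - (PowerSeries.X : PowerSeries ℚ)) ^ (p + 1))⁻¹ =
      PowerSeries.mk fun n : ℕ => ((p + n).choose p : ℚ) := by
    rw [PowerSeries.inv_eq_iff_mul_eq_one (by simp), ← PowerSeries.mk_one_pow_eq_mk_choose_add,
      ← mul_pow, PowerSeries.mk_one_mul_one_sub_eq_one, one_pow]
  rw [hinv]
  ext n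
  rw [PowerSeries.coeff_X_pow_mul', PowerSeries.coeff_mk, PowerSeries.coeff_mk]
  split_ifs with h
  · rw [show n + p - d = p + (n - d) by omega]
  · rw [Nat.choose_eq_zero_of_lt (by omega), Nat.cast_zero]

theorem des_le {m : ℕ} (w : Fin m → ℕ) : des w ≤ m :=
  descentsBefore_length w ▸ descentsBefore_le w m

theorem mk_ncard_posetPartitions {P : Type*} [PartialOrder P] [Fintype P] {ω : P → ℕ}
    (hω : Function.Injective ω) :
    (PowerSeries.mk fun n : ℕ => ((posetPartitions ω n).ncard : ℚ)) =
      (∑ e ∈ (linearExtensions P).toFinite.toFinset, PowerSeries.X ^ des (labelWord ω e)) *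
        ((1 - (PowerSeries.X : PowerSeries ℚ)) ^ (Fintype.card P + 1))⁻¹ := by
  rw [Finset.sum_mul]
  simp_rw [← mk_choose_eq_X_pow_mul (des_le _)]
  ext n
  rw [PowerSeries.coeff_mk, map_sum, ncard_posetPartitions hω, Nat.cast_sum]
  simp_rw [PowerSeries.coeff_mk]

/-! ### The Legendre-Stirling poset -/

namespace LSPoset

/-- The point of `P_k` with the label `3 i + r + 1`. -/
def point {k : ℕ} (i : Fin k) (r : Fin 3) : LSPoset k := (i, r)

theorem label_point {k : ℕ} (i : Fin k) (r : Fin 3) :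
    (point i r).label = 3 * (i : ℕ) + (r : ℕ) + 1 := rfl

theorem label_injective (k : ℕ) : Function.Injective (label : LSPoset k → ℕ) := by
  rintro ⟨i, r⟩ ⟨j, s⟩ h
  have h' : 3 * (i : ℕ) + (r : ℕ) + 1 = 3 * (j : ℕ) + (s : ℕ) + 1 := h
  exact Prod.ext (Fin.ext (by simp only; omega)) (Fin.ext (by simp only; omega))

theorem card (k : ℕ) : Fintype.card (LSPoset k) = 3 * k := by
  rw [show Fintype.card (LSPoset k) = Fintype.card (Fin k × Fin 3) from rfl,
    Fintype.card_prod, Fintype.card_fin, Fintype.card_fin, mul_comm]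

theorem point_le_point {k : ℕ} {i j : Fin k} {r : Fin 3} (h : i ≤ j) :
    point i r ≤ point j 1 :=
  Or.inr ⟨rfl, h⟩

theorem point_lt_point {k : ℕ} {i j : Fin k} {r : Fin 3} (h : i ≤ j) (hne : i ≠ j ∨ r ≠ 1) :
    point i r < point j 1 := by
  refine lt_of_le_of_ne (point_le_point h) fun he => ?_
  rcases hne with hne | hne
  · exact hne (congrArg Prod.fst he)
  · exact hne (congrArg Prod.snd he)

theorem of_point_lt_point {k : ℕ} {i j : Fin k} {r s : Fin 3} (h : point i r < point j s) :
    s = 1 ∧ i ≤ j ∧ (i < j ∨ r ≠ 1) := by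
  rcases h.le with he | ⟨hs, hij⟩
  · exact absurd he h.ne
  · refine ⟨hs, hij, ?_⟩
    rcases hij.lt_or_eq with hlt | he
    · exact Or.inl hlt
    · refine Or.inr fun hr => h.ne (Prod.ext he ?_)
      exact hr.trans hs.symm

/-- Of the two points below a chain point, only `point i 2` has the larger label, hence the strict
inequality. -/
theorem mem_posetPartitions_iff {k n : ℕ} {f : LSPoset k → ℕ} :
    f ∈ posetPartitions label n ↔
      (fun i => f (point i 1)) ∈ monotoneTuples k n ∧
        ∀ i, f (point i 0) ≤ f (point i 1) ∧ f (point i 2) < f (point i 1) := by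
  rw [mem_monotoneTuples]
  constructor
  · rintro ⟨hf, hb⟩
    refine ⟨⟨fun i => hb _, fun i j hij => ?_⟩, fun i => ⟨?_, ?_⟩⟩
    · rcases hij.eq_or_lt with rfl | hlt
      · exact le_rfl
      · have := Prod.Lex.toLex_lt_toLex.1 (hf _ _ (point_lt_point hij (r := 1) (Or.inl hlt.ne)))
        simp only at this ⊢
        omega
    · have := Prod.Lex.toLex_lt_toLex.1 (hf _ _ (point_lt_point (le_refl i) (r := 0) (by simp)))
      simp only at this ⊢
      omega
    · have := Prod.Lex.toLex_lt_toLex.1 (hf _ _ (point_lt_point (le_refl i) (r := 2) (by simp)))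
      simp only [label_point, Fin.val_two, Fin.val_one] at this
      omega
  · rintro ⟨⟨hb, hm⟩, hf⟩
    refine ⟨?_, ?_⟩
    · rintro ⟨i, r⟩ ⟨j, s⟩ hxy
      obtain ⟨rfl, hij, hr⟩ := of_point_lt_point hxy
      change toLex (f (point i r), label (point i r)) < toLex (f (point j 1), label (point j 1))
      have h1 : f (point i 1) ≤ f (point j 1) := hm hij
      have h2 := hf i
      rw [Prod.Lex.toLex_lt_toLex]
      simp only [label_point]
      fin_cases r
      · simp only [Fin.zero_eta, Fin.val_one]
        omega
      · simp only [Fin.mk_one, Fin.val_one]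
        have : i < j := hr.resolve_right fun h => h rfl
        omega
      · simp only [Fin.reduceFinMk]
        omega
    · rintro ⟨i, r⟩
      have h1 := hb i
      have h2 := hf i
      change f (point i r) ≤ n
      fin_cases r
      · exact h2.1.trans h1
      · exact h1
      · exact h2.2.le.trans h1

theorem ncard_posetPartitions_label (k n : ℕ) :
    (posetPartitions (label : LSPoset k → ℕ) n).ncard =
      ∑ c ∈ monotoneTuples k n, ∏ i, c i * (1 + c i) := by
  have h : ∑ c ∈ monotoneTuples k n, ∏ i, c i * (1 + c i) =
      ((monotoneTuples k n).sigma fun c => (Fintype.piFinset fun i => Finset.range (c i + 1)) ×ˢ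
        Fintype.piFinset fun i => Finset.range (c i)).card := by
    rw [Finset.card_sigma]
    refine Finset.sum_congr rfl fun c _ => ?_
    rw [Finset.card_product, Fintype.card_piFinset, Fintype.card_piFinset,
      ← Finset.prod_mul_distrib]
    refine Finset.prod_congr rfl fun i _ => ?_
    rw [Finset.card_range, Finset.card_range, mul_comm, add_comm]
  rw [h, ← Set.ncard_coe_finset]
  refine Set.ncard_congr (fun f _ => ⟨fun i => f (point i 1),
    fun i => f (point i 0), fun i => f (point i 2)⟩) ?_ ?_ ?_
  · intro f hf
    obtain ⟨hc, hf⟩ := mem_posetPartitions_iff.1 hf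
    simp only [Finset.mem_coe, Finset.mem_sigma, Finset.mem_product, Fintype.mem_piFinset,
      Finset.mem_range, Nat.lt_succ_iff]
    exact ⟨hc, fun i => (hf i).1, fun i => (hf i).2⟩
  · intro f f' _ _ heq
    simp only [Sigma.mk.injEq, heq_eq_eq, Prod.mk.injEq] at heq
    funext ⟨i, r⟩
    change f (point i r) = f' (point i r)
    fin_cases r
    · exact congrFun heq.2.1 i
    · exact congrFun heq.1 i
    · exact congrFun heq.2.2 i
  · rintro ⟨c, a, b⟩ hx
    simp only [Finset.mem_coe, Finset.mem_sigma, Finset.mem_product, Fintype.mem_piFinset,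
      Finset.mem_range, Nat.lt_succ_iff] at hx
    refine ⟨fun x => ![a x.1, c x.1, b x.1] x.2, ?_, rfl⟩
    exact mem_posetPartitions_iff.2 ⟨hx.1, fun i => ⟨hx.2.1 i, hx.2.2 i⟩⟩

theorem labelWord_apply {k : ℕ} (e : LSPoset k ≃ Fin (Fintype.card (LSPoset k))) (x : LSPoset k) :
    labelWord label e (e x) = label x := by
  rw [labelWord, Equiv.symm_apply_apply]

/-- Label `3` precedes label `2`, which forces a descent. -/
theorem one_le_des {k : ℕ} (hk : 1 ≤ k) {e : LSPoset k ≃ Fin (Fintype.card (LSPoset k))}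
    (he : e ∈ linearExtensions (LSPoset k)) : 1 ≤ des (labelWord label e) := by
  rw [mem_linearExtensions_iff] at he
  let i : Fin k := ⟨0, hk⟩
  have h := descentsBefore_lt (w := labelWord label e)
    (he _ _ (point_lt_point (le_refl i) (r := 2) (by simp)))
    (by rw [labelWord_apply, labelWord_apply, label_point, label_point]; simp)
  have h' := descentsBefore_mono (labelWord label e) (e (point i 1)).2.le
  rw [descentsBefore_length] at h'
  omega

/-- The labels `1, 2, 5, …, 3k-1` appear in this order, and each of these `k` increases forces a
non-descent among the `3k - 1` adjacent pairs. -/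
theorem des_le {k : ℕ} (hk : 1 ≤ k) {e : LSPoset k ≃ Fin (Fintype.card (LSPoset k))}
    (he : e ∈ linearExtensions (LSPoset k)) : des (labelWord label e) ≤ 2 * k - 1 := by
  rw [mem_linearExtensions_iff] at he
  have hchain : ∀ (i : ℕ) (hi : i < k),
      descentsBefore (labelWord label e) (e (point ⟨i, hi⟩ 1)) + i + 1 ≤
        (e (point ⟨i, hi⟩ 1) : ℕ) := by
    intro i
    induction i with
    | zero =>
      intro hi
      have h := descentsBefore_add_lt (w := labelWord label e)
        (he _ _ (point_lt_point (le_refl ⟨0, hi⟩) (r := 0) (by simp)))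
        (by rw [labelWord_apply, labelWord_apply, label_point, label_point]; simp)
      have h' := descentsBefore_le (labelWord label e) (e (point ⟨0, hi⟩ 0))
      omega
    | succ i ih =>
      intro hi
      have hi' := Nat.lt_of_succ_lt hi
      have h := descentsBefore_add_lt (w := labelWord label e)
        (he (point ⟨i, hi'⟩ 1) (point ⟨i + 1, hi⟩ 1)
          (point_lt_point (Fin.mk_le_mk.2 i.le_succ) (Or.inl (by simp))))
        (by rw [labelWord_apply, labelWord_apply, label_point, label_point]; simp)
      have := ih hi'
      omega
  have h := hchain (k - 1) (by omega)
  set q := e (point ⟨k - 1, by omega⟩ 1)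
  have hq : (q : ℕ) + 1 ≤ Fintype.card (LSPoset k) := q.2
  have h0 : descentsBefore (labelWord label e) (Fintype.card (LSPoset k) - 1) =
      des (labelWord label e) :=
    descentsBefore_pred _
  have h1 := descentsBefore_add_le (labelWord label e)
    (show (q : ℕ) ≤ Fintype.card (LSPoset k) - 1 by omega)
  have := card k
  omega

end LSPoset

/-! ### Grouping by descents and conclusion -/

theorem sum_X_pow_des (k : ℕ) (hk : 1 ≤ k) :
    ∑ e ∈ (linearExtensions (LSPoset k)).toFinite.toFinset,
        (PowerSeries.X : PowerSeries ℚ) ^ des (labelWord LSPoset.label e) =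
      ∑ j ∈ Finset.Icc 1 (2 * k - 1),
        PowerSeries.C (lsDescentNumber k j : ℚ) * (PowerSeries.X : PowerSeries ℚ) ^ j := by
  rw [← Finset.sum_fiberwise_of_maps_to (t := Finset.Icc 1 (2 * k - 1))
    (g := fun e => des (labelWord LSPoset.label e))]
  · refine Finset.sum_congr rfl fun j _ => ?_
    rw [Finset.sum_congr rfl fun e he => by rw [(Finset.mem_filter.1 he).2], Finset.sum_const,
      nsmul_eq_mul, lsDescentNumber, map_natCast, ← Set.ncard_coe_finset]
    congr 3
    ext e
    simp
  · intro e he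
    rw [Set.Finite.mem_toFinset] at he
    exact Finset.mem_Icc.2 ⟨LSPoset.one_le_des hk he, LSPoset.des_le hk he⟩

theorem LS_add_eq_ncard (k n : ℕ) :
    LS (n + k) n = ((posetPartitions (LSPoset.label : LSPoset k → ℕ) n).ncard : ℤ) := by
  rw [LS, JS_add_eq_sum_monotoneTuples, LSPoset.ncard_posetPartitions_label]
  push_cast
  rfl

theorem mainTheorem4 (k : ℕ) (hk : 1 ≤ k) :
    (PowerSeries.mk fun n : ℕ => (LS (n + k) n : ℚ)) =
      (∑ j ∈ Finset.Icc 1 (2 * k - 1),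
          PowerSeries.C (lsDescentNumber k j : ℚ) * (PowerSeries.X : PowerSeries ℚ) ^ j) *
        ((1 - (PowerSeries.X : PowerSeries ℚ)) ^ (3 * k + 1))⁻¹ := by
  rw [← sum_X_pow_des k hk, ← LSPoset.card k,
    ← mk_ncard_posetPartitions (LSPoset.label_injective k)]
  simp_rw [LS_add_eq_ncard, Int.cast_natCast]
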